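/- Let $I\subseteq\mathbb{R}$ be an interval with left end point $l\in[-\infty,\infty)$ and right end point $+\infty$ (so $I=(l,\infty)$, or $l>-\infty$ and $I=[l,\infty)$), and let $X=(X_t)_{t\ge 0}$ with probability measures $(\mathbf{P}_x)_{x\in I}$ be a regular one-dimensional diffusion on $I$ without killing: a strong Markov process with continuous paths, taking values in $I$ at all times $t\ge0$, with $X_0=x$ $\mathbf{P}_x$-a.s., such that $\mathbf{P}_x(H_y<\infty)>0$ for all $x\in I$ and all $y\in(l,\infty)$, where $H_y:=\inf\{t\ge 0: X_t=y\}$. Let $S$ be a scale function of $X$, i.e. a continuous, strictly increasing function on $(l,\infty)$ such that $$\mathbf{P}_x(H_a<H_b)=\frac{S(b)-S(x)}{S(b)-S(a)}\qquad\text{for } l<a<x<b<\infty,$$ and put $S(+\infty):=\lim_{x\to\infty}S(x)$, $S(l):=\lim_{x\downarrow l}S(x)$. Assume that $X$ is in Class 1, that is, $S(+\infty)=+\infty$ and either (a) $S(l)=-\infty$, or (b) $S(l)>-\infty$, $l>-\infty$, $l\in I$, and $l$ is a reflecting boundary: $\mathbf{P}_x(H_l<\infty)>0$ for all $x\in I$,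 and $\{t\ge0:X_t=l\}$ has Lebesgue measure zero $\mathbf{P}_x$-a.s. for all $x\in I$. Let $M_t:=\max_{0\le s\le t}X_s$ and $\theta_\delta:=\inf\{t\ge0: M_t-X_t>\delta\}$, with $\inf\emptyset:=+\infty$ and $M_{+\infty}:=\sup_{s\ge0}X_s$. Then for every $x\in I$, $\mathbf{P}_x$-almost surely, $\theta_\delta<\infty$ and $M_{\theta_\delta}<\infty$ for all $\delta>0$. -/

import Mathlib

open MeasureTheory ProbabilityTheory Filter Topology Set
open scoped NNReal ENNReal

noncomputable section

namespace Drawdown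

/-- `I` is an interval with left end point `l ∈ [-∞, ∞)` and right end point `+∞`:
either `I = (l, ∞)`, or `l` is finite and `I = [l, ∞)`. -/
structure IsStateInterval (l : EReal) (I : Set ℝ) : Prop where
  lt_top : l < ⊤
  interior_subset : {x : ℝ | l < (x : EReal)} ⊆ I
  subset_closure : I ⊆ {x : ℝ | l ≤ (x : EReal)}

/-- The first hitting time `H_y = inf {t ≥ 0 : X_t = y}`, equal to `⊤` if `y` is never hit. -/
def hitTime {Ω : Type*} {I : Set ℝ} (X : ℝ≥0 → Ω → I) (y : I) : Ω → WithTop ℝ≥0 :=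
  hittingAfter X {y} 0

/-- The strong Markov property of the family `(P_x)` of laws of `X`, at the stopping times `τ` of
the filtration generated by `X`: on `{τ < ∞}`, the conditional law under `P_x` of the path
`(X_{τ + t})_{t ≥ 0}` given the past `F_τ` is the law of `X` under `P_{X_τ}`. -/
def StrongMarkov {Ω : Type*} [MeasurableSpace Ω] {I : Set ℝ} (X : ℝ≥0 → Ω → I) (hX : ∀ t, Measurable (X t))
    (P : Kernel I Ω) : Prop :=
  ∀ (τ : Ω → WithTop ℝ≥0)
    (hτ : IsStoppingTime (Filtration.natural X fun t => (hX t).stronglyMeasurable) τ)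
    (A : Set Ω), MeasurableSet[hτ.measurableSpace] A →
    ∀ B : Set (ℝ≥0 → I), MeasurableSet B → ∀ x : I,
      P x (A ∩ {ω | τ ω < ⊤} ∩ {ω | (fun t => X ((τ ω).untopD 0 + t) ω) ∈ B}) =
        ∫⁻ ω in A ∩ {ω | τ ω < ⊤}, P (X ((τ ω).untopD 0) ω) {ω' | (fun t => X t ω') ∈ B} ∂(P x)

/-- `X`, under the probability measures `(P_x)_{x ∈ I}`, is a regular one-dimensional diffusion
on the interval `I` with end points `l` and `+∞`, which is not killed: a strong Markov process
with continuous paths which stay in `I` at all times `t ≥ 0`, started from `x` under `P_x`, and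
which can reach every interior point of `I` from every point of `I`. -/
structure IsRegularDiffusion {Ω : Type*} [MeasurableSpace Ω] (l : EReal) (I : Set ℝ)
    (X : ℝ≥0 → Ω → I) (P : Kernel I Ω) : Prop where
  interval : IsStateInterval l I
  markovKernel : IsMarkovKernel P
  measurable : ∀ t, Measurable (X t)
  continuous : ∀ ω, Continuous fun t => X t ω
  start : ∀ x, ∀ᵐ ω ∂(P x), X 0 ω = x
  strongMarkov : StrongMarkov X measurable P
  regular : ∀ x y : I, l < ((y : ℝ) : EReal) → 0 < P x {ω | hitTime X y ω < ⊤}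

/-- `S` is a scale function of the diffusion: continuous and strictly increasing on the interior
`(l, ∞)` of the state space, with `P_x(H_a < H_b) = (S(b) - S(x)) / (S(b) - S(a))` for
`l < a < x < b`. (The values of `S` outside `(l, ∞)` are irrelevant.) -/
structure IsScaleFunction {Ω : Type*} [MeasurableSpace Ω] (l : EReal) {I : Set ℝ}
    (X : ℝ≥0 → Ω → I) (P : Kernel I Ω) (S : ℝ → ℝ) : Prop where
  continuousOn : ContinuousOn S {x : ℝ | l < (x : EReal)}
  strictMonoOn : StrictMonoOn S {x : ℝ | l < (x : EReal)}
  hitting : ∀ a x b : I, l < ((a : ℝ) : EReal) → a < x → x < b →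
    (P x).real {ω | hitTime X a ω < hitTime X b ω} = (S b - S x) / (S b - S a)

/-- The point `l₀` of the state space, its left end point in the application, is a reflecting
boundary: it is reached with positive probability from every point, and the process spends
no time there, i.e. `{t : X_t = l₀}` is almost surely Lebesgue-null. (That it is not absorbing
is part of the regularity of the diffusion.) -/
structure IsReflecting {Ω : Type*} [MeasurableSpace Ω] {I : Set ℝ} (X : ℝ≥0 → Ω → I)
    (P : Kernel I Ω) (l₀ : I) : Prop where
  accessible : ∀ x : I, 0 < P x {ω | hitTime X l₀ ω < ⊤}
  null_time : ∀ x : I, ∀ᵐ ω ∂(P x), volume (((↑) : ℝ≥0 → ℝ) '' {t : ℝ≥0 | X t ω = l₀}) = 0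

/-- Class 1a: `S(+∞) = +∞` and `S(l) = -∞`. The filter is that of `x → l`, `x > l`; it is
`𝓝[>] l` for finite `l`, and `atBot` for `l = -∞`. -/
def IsClassOneA (l : EReal) (S : ℝ → ℝ) : Prop :=
  Tendsto S atTop atTop ∧ Tendsto S (comap ((↑) : ℝ → EReal) (𝓝[>] l)) atBot

/-- Class 1b: `S(+∞) = +∞`, `S(l) > -∞`, and `l > -∞` is a point of the state space and a
reflecting boundary. -/
def IsClassOneB {Ω : Type*} [MeasurableSpace Ω] (l : EReal) {I : Set ℝ} (X : ℝ≥0 → Ω → I)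
    (P : Kernel I Ω) (S : ℝ → ℝ) : Prop :=
  Tendsto S atTop atTop ∧
    ∃ l₀ : I, l = ((l₀ : ℝ) : EReal) ∧ (∃ s : ℝ, Tendsto S (𝓝[>] (l₀ : ℝ)) (𝓝 s)) ∧
      IsReflecting X P l₀

/-- The running maximum `M_t = max_{0 ≤ s ≤ t} X_s`. -/
def runningMax {Ω : Type*} {I : Set ℝ} (X : ℝ≥0 → Ω → I) (t : ℝ≥0) (ω : Ω) : ℝ :=
  sSup ((fun s => (X s ω : ℝ)) '' Icc 0 t)

/-- The first drawdown time `θ_δ = inf {t ≥ 0 : M_t - X_t > δ}`, equal to `⊤` if there is no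
such `t`. -/
def drawdownTime {Ω : Type*} {I : Set ℝ} (X : ℝ≥0 → Ω → I) (δ : ℝ) : Ω → WithTop ℝ≥0 :=
  hittingAfter (fun t ω => runningMax X t ω - (X t ω : ℝ)) (Ioi δ) 0

/-- The maximum `M_τ` up to a possibly infinite time `τ`, with `M_∞ = sup_{s ≥ 0} X_s`. -/
def maxUpTo {Ω : Type*} {I : Set ℝ} (X : ℝ≥0 → Ω → I) (τ : WithTop ℝ≥0) (ω : Ω) : EReal :=
  ⨆ (s : ℝ≥0) (_ : (s : WithTop ℝ≥0) ≤ τ), ((X s ω : ℝ) : EReal)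

/-- For a continuous path, the maximum up to a finite time is the running maximum. -/
theorem maxUpTo_coe {Ω : Type*} {I : Set ℝ} (X : ℝ≥0 → Ω → I) (t : ℝ≥0) (ω : Ω)
    (hc : Continuous fun s => X s ω) :
    maxUpTo X (t : WithTop ℝ≥0) ω = (runningMax X t ω : EReal) := by
  have hc' : Continuous fun s => (X s ω : ℝ) := continuous_subtype_val.comp hc
  have hK : IsCompact ((fun s => (X s ω : ℝ)) '' Icc 0 t) := isCompact_Icc.image hc'
  apply le_antisymm
  · refine iSup₂_le fun s hs => ?_
    have hs' : s ≤ t := WithTop.coe_le_coe.1 hs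
    exact EReal.coe_le_coe_iff.2 (le_csSup hK.bddAbove ⟨s, ⟨zero_le, hs'⟩, rfl⟩)
  · obtain ⟨s, hs, h⟩ := hK.sSup_mem ⟨_, ⟨0, ⟨le_rfl, zero_le⟩, rfl⟩⟩
    have h' : runningMax X t ω = (X s ω : ℝ) := h.symm
    rw [h']
    exact le_iSup₂_of_le s (WithTop.coe_le_coe.2 hs.2) le_rfl

end Drawdown

end

/-!
The diffusion makes arbitrarily large drawdowns because it is recurrent: it comes above every level
`y`, and from there returns below any fixed interior level `c`, so that a drawdown larger than
`y - c` occurs almost surely (`Drawdown.IsRegularDiffusion.ae_exists_lt_and_exists_gt`). Once the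
drawdown time is finite, so is the maximum up to it, by continuity.

* Descending to an interior level `a` from `x > a` is certain
  (`Drawdown.IsRegularDiffusion.ae_exists_eq_of_lt`), since
  `P_x(H_a < ∞) ≥ P_x(H_a < H_b) = (S(b) - S(x)) / (S(b) - S(a)) → 1` as `b → ∞`.
* Ascending from an interior point when `S(l) = -∞` is certain
  (`Drawdown.IsRegularDiffusion.ae_exists_eq_of_gt`): a path that misses `y` still descends to every
  `a < x`, hence does so before `H_y = ∞`, and `P_x(H_a < H_y) → 0` as `a → l`.
* If `l` is a point of the state space, which covers the reflecting case and also an entrance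
  boundary with `S(l) = -∞`, the scale function does not help at `l` itself. There ascending follows
  from regularity (`Drawdown.IsRegularDiffusion.ae_exists_lt_of_left_mem`): the probability to
  exceed `y` within a suitable time `T` is positive from `l`, and by the strong Markov property at
  `H_w` it is at least as large from every other point `w`, so staying below `y` forever has
  probability zero.
-/

open MeasureTheory ProbabilityTheory Filter Topology Set TopologicalSpace
open scoped NNReal ENNReal

namespace Drawdown

variable {Ω : Type*} {I : Set ℝ} {X : ℝ≥0 → Ω → I}

/-! ### Hitting times of continuous paths -/

/-- Events about an uncountable set of times become countable ones when the target is open. -/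
theorem exists_denseSeq_mem_iff {α β : Type*} [TopologicalSpace α] [SeparableSpace α] [Nonempty α]
    [TopologicalSpace β] {f : α → β} (hf : Continuous f) {U : Set β} (hU : IsOpen U) :
    (∃ k, f (denseSeq α k) ∈ U) ↔ ∃ a, f a ∈ U := by
  refine ⟨fun ⟨k, hk⟩ => ⟨_, hk⟩, fun ⟨a, ha⟩ => ?_⟩
  obtain ⟨k, hk⟩ := (denseRange_denseSeq α).exists_mem_open (hU.preimage hf) ⟨a, ha⟩
  exact ⟨k, hk⟩

theorem hitTime_lt_top_iff {y : I} {ω : Ω} : hitTime X y ω < ⊤ ↔ ∃ t, X t ω = y := by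
  rw [lt_top_iff_ne_top, hitTime, Ne, hittingAfter_eq_top_iff]
  push Not
  simp

/-- A continuous path is at `y` at the time `H_y`, if that time is finite. -/
theorem apply_hitTime {y : I} {ω : Ω} (hc : Continuous fun t => X t ω)
    (h : hitTime X y ω < ⊤) : X ((hitTime X y ω).untopD 0) ω = y := by
  classical
  obtain ⟨t, ht⟩ := hitTime_lt_top_iff.1 h
  have hne : ({i : ℝ≥0 | 0 ≤ i ∧ X i ω ∈ ({y} : Set I)}).Nonempty := ⟨t, zero_le, ht⟩
  have hcl : IsClosed {i : ℝ≥0 | 0 ≤ i ∧ X i ω ∈ ({y} : Set I)} := by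
    have : {i : ℝ≥0 | 0 ≤ i ∧ X i ω ∈ ({y} : Set I)} = (fun t => X t ω) ⁻¹' {y} := by
      ext i; simp
    rw [this]
    exact isClosed_singleton.preimage hc
  have hmem := hcl.csInf_mem hne (OrderBot.bddBelow _)
  have heq : hitTime X y ω =
      ((sInf {i : ℝ≥0 | 0 ≤ i ∧ X i ω ∈ ({y} : Set I)} : ℝ≥0) : WithTop ℝ≥0) := by
    rw [hitTime, hittingAfter_def]
    exact if_pos ⟨t, zero_le, ht⟩
  rw [heq]
  exact hmem.2

theorem hitTime_le_of_apply_eq {y : I} {ω : Ω} {s : ℝ≥0} (h : X s ω = y) :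
    hitTime X y ω ≤ s :=
  hittingAfter_le_of_mem zero_le h

theorem hitTime_le_coe_iff {y : I} {ω : Ω} (hc : Continuous fun t => X t ω) {t : ℝ≥0} :
    hitTime X y ω ≤ t ↔ ∃ s ≤ t, X s ω = y := by
  constructor
  · intro h
    have hlt : hitTime X y ω < ⊤ := h.trans_lt (WithTop.coe_lt_top t)
    refine ⟨(hitTime X y ω).untopD 0, ?_, apply_hitTime hc hlt⟩
    lift hitTime X y ω to ℝ≥0 using hlt.ne with r
    exact WithTop.coe_le_coe.1 h
  · rintro ⟨s, hs, h⟩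
    exact (hitTime_le_of_apply_eq h).trans (WithTop.coe_le_coe.2 hs)

theorem drawdownTime_lt_top {δ : ℝ} {ω : Ω} (hc : Continuous fun t => X t ω) {s t : ℝ≥0}
    (hst : s ≤ t) (h : δ < (X s ω : ℝ) - X t ω) : drawdownTime X δ ω < ⊤ := by
  refine lt_of_le_of_lt (hittingAfter_le_of_mem (i := t) zero_le ?_) (WithTop.coe_lt_top t)
  have hK : IsCompact ((fun s => (X s ω : ℝ)) '' Icc 0 t) :=
    isCompact_Icc.image (continuous_subtype_val.comp hc)
  have hle : (X s ω : ℝ) ≤ runningMax X t ω :=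
    le_csSup hK.bddAbove ⟨s, ⟨zero_le, hst⟩, rfl⟩
  change δ < runningMax X t ω - X t ω
  linarith

variable [MeasurableSpace Ω]

/-- Hitting times of points by a continuous process are stopping times of its natural filtration:
by compactness, `y` is visited by time `t` exactly if the path comes arbitrarily close to `y` at
times of a countable dense subset of `[0, t]`. -/
theorem isStoppingTime_hitTime (hX : ∀ t, Measurable (X t)) (hc : ∀ ω, Continuous fun t => X t ω)
    (y : I) :
    IsStoppingTime (Filtration.natural X fun t => (hX t).stronglyMeasurable) (hitTime X y) := by
  intro t
  have heq : {ω | hitTime X y ω ≤ t} =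
      ⋂ n : ℕ, ⋃ k : ℕ, X (denseSeq (Iic t) k : Iic t) ⁻¹' Metric.ball y (1 / ((n : ℝ) + 1)) := by
    ext ω
    have hcω : Continuous fun s : Iic t => X s ω := (hc ω).comp continuous_subtype_val
    simp only [mem_ofPred_eq, hitTime_le_coe_iff (hc ω), mem_iInter, mem_iUnion, mem_preimage]
    have hiff := fun n : ℕ => exists_denseSeq_mem_iff hcω
      (Metric.isOpen_ball (x := y) (ε := 1 / ((n : ℝ) + 1)))
    constructor
    · rintro ⟨s, hs, h⟩ n
      refine (hiff n).2 ⟨⟨s, hs⟩, ?_⟩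
      simp only [h]
      exact Metric.mem_ball_self (by positivity)
    · intro h
      have hK : IsCompact (Icc 0 t) := isCompact_Icc
      obtain ⟨s, hs, hmin⟩ := hK.exists_isMinOn ⟨0, le_rfl, zero_le⟩
        ((hc ω).dist continuous_const).continuousOn (f := fun s => dist (X s ω) y)
      refine ⟨s, hs.2, ?_⟩
      by_contra hne
      obtain ⟨n, hn⟩ := exists_nat_one_div_lt (dist_pos.2 hne)
      obtain ⟨r, hr⟩ := (hiff n).1 (h n)
      have h1 : dist (X s ω) y ≤ dist (X r ω) y := hmin ⟨zero_le, r.2⟩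
      have h2 : dist (X r ω) y < 1 / ((n : ℝ) + 1) := hr
      linarith
  rw [heq]
  refine MeasurableSet.iInter fun n => MeasurableSet.iUnion fun k => ?_
  have hm := (Filtration.stronglyAdapted_natural fun t => (hX t).stronglyMeasurable)
    (denseSeq (Iic t) k : Iic t)
  exact (Filtration.natural X fun t => (hX t).stronglyMeasurable).mono (denseSeq (Iic t) k).2 _
    (hm.measurable Metric.isOpen_ball.measurableSet)

/-! ### Events of path space -/

/-- The paths which exceed the level `y` by time `T`. Only the times of a dense sequence are
tested, so that the set is measurable for the product `σ`-algebra; for continuous paths this makes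
no difference. -/
def exceedBefore (I : Set ℝ) (T : ℝ≥0) (y : ℝ) : Set (ℝ≥0 → I) :=
  {p | ∃ k, y < (p (denseSeq (Iic T) k : Iic T) : ℝ)}

/-- The paths which never exceed the level `y`, tested at the times of a dense sequence. -/
def neverAbove (I : Set ℝ) (y : ℝ) : Set (ℝ≥0 → I) :=
  {p | ∀ k, (p (denseSeq ℝ≥0 k) : ℝ) ≤ y}

/-- The paths which never go below the level `y`, tested at the times of a dense sequence. -/
def neverBelow (I : Set ℝ) (y : ℝ) : Set (ℝ≥0 → I) :=
  {p | ∀ k, y ≤ (p (denseSeq ℝ≥0 k) : ℝ)}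

theorem measurableSet_exceedBefore (T : ℝ≥0) (y : ℝ) : MeasurableSet (exceedBefore I T y) := by
  simp only [exceedBefore, ofPred_exists]
  exact MeasurableSet.iUnion fun k =>
    measurableSet_lt measurable_const (measurable_subtype_coe.comp (measurable_pi_apply _))

theorem measurableSet_neverAbove (y : ℝ) : MeasurableSet (neverAbove I y) := by
  simp only [neverAbove, ofPred_forall]
  exact MeasurableSet.iInter fun k =>
    measurableSet_le (measurable_subtype_coe.comp (measurable_pi_apply _)) measurable_const

theorem measurableSet_neverBelow (y : ℝ) : MeasurableSet (neverBelow I y) := by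
  simp only [neverBelow, ofPred_forall]
  exact MeasurableSet.iInter fun k =>
    measurableSet_le measurable_const (measurable_subtype_coe.comp (measurable_pi_apply _))

theorem mem_exceedBefore_iff {p : ℝ≥0 → I} (hp : Continuous p) {T : ℝ≥0} {y : ℝ} :
    p ∈ exceedBefore I T y ↔ ∃ s ≤ T, y < (p s : ℝ) := by
  have h := exists_denseSeq_mem_iff (f := fun s : Iic T => (p s : ℝ))
    (continuous_subtype_val.comp (hp.comp continuous_subtype_val)) (isOpen_Ioi (a := y))
  simpa [exceedBefore] using h

theorem mem_neverAbove_iff {p : ℝ≥0 → I} (hp : Continuous p) {y : ℝ} :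
    p ∈ neverAbove I y ↔ ∀ s, (p s : ℝ) ≤ y := by
  have h := exists_denseSeq_mem_iff (f := fun s => (p s : ℝ))
    (continuous_subtype_val.comp hp) (isOpen_Ioi (a := y))
  simpa [neverAbove] using not_congr h

theorem mem_neverBelow_iff {p : ℝ≥0 → I} (hp : Continuous p) {y : ℝ} :
    p ∈ neverBelow I y ↔ ∀ s, y ≤ (p s : ℝ) := by
  have h := exists_denseSeq_mem_iff (f := fun s => (p s : ℝ))
    (continuous_subtype_val.comp hp) (isOpen_Iio (a := y))
  simpa [neverBelow] using not_congr h

/-! ### The Markov property at fixed times -/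

variable {l : EReal} {P : Kernel I Ω} {S : ℝ → ℝ}

theorem StrongMarkov.at_const {hX : ∀ t, Measurable (X t)} (h : StrongMarkov X hX P) (t : ℝ≥0)
    {A : Set Ω}
    (hA : MeasurableSet[Filtration.natural X (fun t => (hX t).stronglyMeasurable) t] A)
    {B : Set (ℝ≥0 → I)} (hB : MeasurableSet B) (x : I) :
    P x (A ∩ {ω | (fun s => X (t + s) ω) ∈ B}) =
      ∫⁻ ω in A, P (X t ω) {ω' | (fun s => X s ω') ∈ B} ∂(P x) := by
  have h' := h (fun _ => (t : WithTop ℝ≥0)) (isStoppingTime_const _ t) A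
    (by rwa [IsStoppingTime.measurableSpace_const]) B hB x
  have huniv : {_ω : Ω | (t : WithTop ℝ≥0) < ⊤} = univ :=
    eq_univ_of_forall fun _ => WithTop.coe_lt_top t
  rw [huniv, inter_univ] at h'
  exact h'

/-! ### Reaching high levels from a closed left end point -/

namespace IsRegularDiffusion

theorem measurableSet_path (hX : IsRegularDiffusion l I X P) {B : Set (ℝ≥0 → I)}
    (hB : MeasurableSet B) : MeasurableSet {ω | (fun s => X s ω) ∈ B} :=
  measurable_pi_lambda _ hX.measurable hB

theorem continuous_shift (hX : IsRegularDiffusion l I X P) (t : ℝ≥0) (ω : Ω) :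
    Continuous fun s => X (t + s) ω :=
  (hX.continuous ω).comp (continuous_const_add t)

theorem coe_lt_of_lt (hX : IsRegularDiffusion l I X P) {w : I} {y : ℝ} (h : (w : ℝ) < y) :
    l < (y : EReal) :=
  (hX.interval.subset_closure w.2).trans_lt (EReal.coe_lt_coe_iff.2 h)

/-- A path from `l₀` to above `y` passes through every `w` in between, and then needs even less time
to exceed `y`. -/
theorem measure_exceedBefore_le (hX : IsRegularDiffusion l I X P) {l₀ : I}
    (hl₀ : l = ((l₀ : ℝ) : EReal)) (T : ℝ≥0) (y : ℝ) (w : I) :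
    P l₀ {ω | (fun s => X s ω) ∈ exceedBefore I T y} ≤
      P w {ω | (fun s => X s ω) ∈ exceedBefore I T y} := by
  have := hX.markovKernel
  rcases lt_or_ge y (w : ℝ) with hyw | hwy
  · have h1 : P w {ω | (fun s => X s ω) ∈ exceedBefore I T y} = 1 := by
      refine (mem_ae_iff_prob_eq_one
        (hX.measurableSet_path (measurableSet_exceedBefore T y))).1 ?_
      filter_upwards [hX.start w] with ω h0
      exact (mem_exceedBefore_iff (hX.continuous ω)).2 ⟨0, zero_le, by simpa [h0] using hyw⟩
    rw [h1]
    exact prob_le_one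
  have hlw : (l₀ : ℝ) ≤ w := by
    have := hX.interval.subset_closure w.2
    rw [hl₀] at this
    exact EReal.coe_le_coe_iff.1 this
  have hsm := hX.strongMarkov _ (isStoppingTime_hitTime hX.measurable hX.continuous w) univ
    MeasurableSet.univ _ (measurableSet_exceedBefore T y) l₀
  simp only [univ_inter] at hsm
  calc P l₀ {ω | (fun s => X s ω) ∈ exceedBefore I T y}
      ≤ P l₀ ({ω | hitTime X w ω < ⊤} ∩
          {ω | (fun t => X ((hitTime X w ω).untopD 0 + t) ω) ∈ exceedBefore I T y}) := by
        refine measure_mono_ae ?_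
        filter_upwards [hX.start l₀] with ω h0 hω
        obtain ⟨s, hs, hys⟩ := (mem_exceedBefore_iff (hX.continuous ω)).1 hω
        have hcω := continuous_subtype_val.comp (hX.continuous ω)
        obtain ⟨r, hr, hrw⟩ := intermediate_value_Icc (zero_le (a := s)) hcω.continuousOn
          (show (w : ℝ) ∈ Icc _ _ from ⟨by simpa [h0] using hlw, hwy.trans hys.le⟩)
        have hrw' : X r ω = w := Subtype.ext hrw
        have hlt : hitTime X w ω < ⊤ := hitTime_lt_top_iff.2 ⟨r, hrw'⟩
        have hle := hitTime_le_of_apply_eq hrw'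
        refine ⟨hlt, ?_⟩
        simp only [mem_ofPred_eq]
        lift hitTime X w ω to ℝ≥0 using hlt.ne with τ
        have hτs : τ ≤ s := (WithTop.coe_le_coe.1 hle).trans hr.2
        refine (mem_exceedBefore_iff (hX.continuous_shift τ ω)).2
          ⟨s - τ, tsub_le_self.trans hs, ?_⟩
        rwa [add_tsub_cancel_of_le hτs]
    _ = ∫⁻ ω in {ω | hitTime X w ω < ⊤}, P (X ((hitTime X w ω).untopD 0) ω)
          {ω' | (fun t => X t ω') ∈ exceedBefore I T y} ∂(P l₀) := hsm
    _ ≤ ∫⁻ ω in {ω | hitTime X w ω < ⊤}, P w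
          {ω' | (fun t => X t ω') ∈ exceedBefore I T y} ∂(P l₀) := by
        refine setLIntegral_mono measurable_const fun ω hω => ?_
        rw [apply_hitTime (hX.continuous ω) hω]
    _ ≤ P w {ω | (fun s => X s ω) ∈ exceedBefore I T y} := by
        rw [setLIntegral_const]
        exact mul_le_of_le_one_right' prob_le_one

theorem exists_measure_exceedBefore_pos (hX : IsRegularDiffusion l I X P) (x : I) (y : ℝ) :
    ∃ T, 0 < P x {ω | (fun s => X s ω) ∈ exceedBefore I T y} := by
  by_contra! h
  have hly : l < ((max (x : ℝ) y + 1 : ℝ) : EReal) :=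
    hX.coe_lt_of_lt (w := x) (by linarith [le_max_left (x : ℝ) y])
  have hpos := hX.regular x ⟨_, hX.interval.interior_subset hly⟩ hly
  refine hpos.ne' (measure_mono_null ?_
    (measure_iUnion_null fun n : ℕ => nonpos_iff_eq_zero.1 (h n)))
  intro ω hω
  obtain ⟨t, ht⟩ := hitTime_lt_top_iff.1 hω
  obtain ⟨n, hn⟩ := exists_nat_ge t
  refine mem_iUnion.2 ⟨n, (mem_exceedBefore_iff (hX.continuous ω)).2 ⟨t, hn, ?_⟩⟩
  rw [ht]
  linarith [le_max_right (x : ℝ) y]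

/-- If the left end point `l₀` belongs to the state space, every level is exceeded almost surely.
The chance to exceed `y` within a suitable time `T` is at least some `p > 0`, uniformly in the
starting point, so by the Markov property at `T` the supremum `u` of the probabilities never to
exceed `y` satisfies `u ≤ u (1 - p)`. -/
theorem ae_exists_lt_of_left_mem (hX : IsRegularDiffusion l I X P) {l₀ : I}
    (hl₀ : l = ((l₀ : ℝ) : EReal)) (x : I) (y : ℝ) :
    ∀ᵐ ω ∂(P x), ∃ t, y < (X t ω : ℝ) := by
  have := hX.markovKernel
  obtain ⟨T, hT⟩ := hX.exists_measure_exceedBefore_pos l₀ y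
  set E : Set Ω := {ω | (fun s => X s ω) ∈ exceedBefore I T y} with hE
  set N : Set Ω := {ω | (fun s => X s ω) ∈ neverAbove I y} with hN
  set u : ℝ≥0∞ := ⨆ w, P w N with hu
  have hEm : MeasurableSet E := hX.measurableSet_path (measurableSet_exceedBefore T y)
  -- the event is already decided at time `T`
  have hEF : MeasurableSet[Filtration.natural X
      (fun t => (hX.measurable t).stronglyMeasurable) T] Eᶜ := by
    refine MeasurableSet.compl ?_
    have : E = ⋃ k, X (denseSeq (Iic T) k : Iic T) ⁻¹' {z | y < (z : ℝ)} := by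
      ext ω; simp [hE, exceedBefore]
    rw [this]
    refine MeasurableSet.iUnion fun k => ?_
    have hm := (Filtration.stronglyAdapted_natural
      fun t => (hX.measurable t).stronglyMeasurable) (denseSeq (Iic T) k : Iic T)
    exact Filtration.mono _ (denseSeq (Iic T) k).2 _
      (hm.measurable (measurableSet_lt measurable_const measurable_subtype_coe))
  have hstep : ∀ w, P w N ≤ u * (1 - P l₀ E) := fun w => by
    calc P w N ≤ P w (Eᶜ ∩ {ω | (fun s => X (T + s) ω) ∈ neverAbove I y}) := by
          refine measure_mono fun ω hω => ?_
          have hle := (mem_neverAbove_iff (hX.continuous ω)).1 hω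
          refine ⟨fun hωE => ?_, ?_⟩
          · obtain ⟨s, -, hs⟩ := (mem_exceedBefore_iff (hX.continuous ω)).1 hωE
            exact (hle s).not_gt hs
          · exact (mem_neverAbove_iff (hX.continuous_shift T ω)).2
              fun s => hle (T + s)
      _ = ∫⁻ ω in Eᶜ, P (X T ω) N ∂(P w) :=
          hX.strongMarkov.at_const T hEF (measurableSet_neverAbove y) w
      _ ≤ ∫⁻ ω in Eᶜ, u ∂(P w) :=
          setLIntegral_mono measurable_const fun ω _ => le_iSup (fun w => P w N) _
      _ = u * (1 - P w E) := by rw [setLIntegral_const, prob_compl_eq_one_sub hEm]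
      _ ≤ u * (1 - P l₀ E) := by
          refine mul_le_mul_right (tsub_le_tsub_left ?_ 1) u
          exact hX.measure_exceedBefore_le hl₀ T y w
  have hu1 : u ≤ 1 := iSup_le fun w => prob_le_one
  have hule : u ≤ u * (1 - P l₀ E) := iSup_le hstep
  have hadd : u * P l₀ E + u * (1 - P l₀ E) = u := by
    rw [← mul_add, add_tsub_cancel_of_le prob_le_one, mul_one]
  have hu0 : u = 0 := by
    have hfin : u * (1 - P l₀ E) ≠ ∞ := by
      refine ne_top_of_le_ne_top (ne_top_of_le_ne_top ENNReal.one_ne_top hu1) ?_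
      exact mul_le_of_le_one_right' tsub_le_self
    have h0 : u * P l₀ E ≤ 0 := by
      refine (ENNReal.add_le_add_iff_right hfin).1 ?_
      rw [hadd, zero_add]
      exact hule
    exact (mul_eq_zero.1 (nonpos_iff_eq_zero.1 h0)).resolve_right hT.ne'
  have hNx : P x N = 0 := nonpos_iff_eq_zero.1 (hu0 ▸ le_iSup (fun w => P w N) x)
  filter_upwards [measure_eq_zero_iff_ae_notMem.1 hNx] with ω hω
  by_contra! h
  exact hω ((mem_neverAbove_iff (hX.continuous ω)).2 h)

/-! ### Hitting probabilities from the scale function -/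

/-- Lower levels are hit almost surely, as `P_x(H_a < H_b) → 1` for `b → ∞`. -/
theorem ae_exists_eq_of_lt (hX : IsRegularDiffusion l I X P) (hS : IsScaleFunction l X P S)
    (htop : Tendsto S atTop atTop) {a x : I} (ha : l < ((a : ℝ) : EReal)) (hax : a < x) :
    ∀ᵐ ω ∂(P x), ∃ t, X t ω = a := by
  have := hX.markovKernel
  have hm : MeasurableSet {ω | hitTime X a ω < ⊤} := by
    have : {ω | hitTime X a ω < ⊤} = ⋃ n : ℕ, {ω | hitTime X a ω ≤ ((n : ℝ≥0) : WithTop ℝ≥0)} := by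
      ext ω
      simp only [mem_ofPred_eq, mem_iUnion]
      refine ⟨fun h => ?_, fun ⟨n, hn⟩ => hn.trans_lt (WithTop.coe_lt_top _)⟩
      lift hitTime X a ω to ℝ≥0 using h.ne with r
      exact (exists_nat_ge r).imp fun n hn => WithTop.coe_le_coe.2 hn
    rw [this]
    exact MeasurableSet.iUnion fun n => Filtration.le _ _ _
      (isStoppingTime_hitTime hX.measurable hX.continuous a n)
  have hlim : Tendsto (fun b => (S b - S x) / (S b - S a)) atTop (𝓝 1) := by
    have h1 : Tendsto (fun b => 1 - (S x - S a) / (S b - S a)) atTop (𝓝 (1 - 0)) :=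
      tendsto_const_nhds.sub (tendsto_const_nhds.div_atTop (tendsto_atTop_add_const_right _ _ htop))
    rw [sub_zero] at h1
    refine h1.congr' ?_
    filter_upwards [htop.eventually_gt_atTop (S a)] with b hb
    have : S b - S a ≠ 0 := (sub_pos.2 hb).ne'
    field_simp
    ring
  have hge : 1 ≤ (P x).real {ω | hitTime X a ω < ⊤} := by
    refine le_of_tendsto hlim ?_
    filter_upwards [eventually_gt_atTop (x : ℝ)] with b hb
    rw [← hS.hitting a x ⟨b, hX.interval.interior_subset (hX.coe_lt_of_lt hb)⟩ ha hax hb]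
    exact measureReal_mono fun ω (hω : hitTime X a ω < _) => lt_top_of_lt hω
  have h1 : P x {ω | hitTime X a ω < ⊤} = 1 := by
    rw [← ENNReal.toReal_eq_one_iff]
    exact le_antisymm measureReal_le_one hge
  filter_upwards [(mem_ae_iff_prob_eq_one hm).2 h1] with ω hω using hitTime_lt_top_iff.1 hω

/-- If `S(l) = -∞`, higher levels are hit almost surely from interior points: a path which does not
hit `y` hits all lower levels `a` before `y`, and `P_x(H_a < H_y) → 0` for `a → l`. -/
theorem ae_exists_eq_of_gt (hX : IsRegularDiffusion l I X P) (hS : IsScaleFunction l X P S)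
    (hA : IsClassOneA l S) {x y : I} (hx : l < ((x : ℝ) : EReal)) (hxy : x < y) :
    ∀ᵐ ω ∂(P x), ∃ t, X t ω = y := by
  have := hX.markovKernel
  -- `l` is a limit of reals from the right, so that limits along this filter are meaningful
  have hne : (comap ((↑) : ℝ → EReal) (𝓝[>] l)).NeBot := by
    refine comap_neBot_iff.2 fun s hs => ?_
    obtain ⟨u, hu, hus⟩ := (mem_nhdsGT_iff_exists_Ioo_subset' hx).1 hs
    obtain ⟨r, hr1, hr2⟩ := EReal.lt_iff_exists_real_btwn.1 (show l < u from hu)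
    exact ⟨r, hus ⟨hr1, hr2⟩⟩
  have hlx : Ioo l ((x : ℝ) : EReal) ∈ 𝓝[>] l := Ioo_mem_nhdsGT hx
  have hlim : Tendsto (fun a => (S y - S x) / (S y - S a))
      (comap ((↑) : ℝ → EReal) (𝓝[>] l)) (𝓝 0) :=
    tendsto_const_nhds.div_atTop
      (tendsto_atTop_add_const_left _ _ (tendsto_neg_atBot_atTop.comp hA.2))
  have hle : (P x).real {ω | hitTime X y ω = ⊤} ≤ 0 := by
    refine ge_of_tendsto hlim ?_
    filter_upwards [preimage_mem_comap hlx] with a ha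
    have hax : a < (x : ℝ) := EReal.coe_lt_coe_iff.1 ha.2
    let a' : I := ⟨a, hX.interval.interior_subset ha.1⟩
    rw [← hS.hitting a' x y ha.1 hax hxy]
    refine ENNReal.toReal_mono (measure_ne_top _ _) (measure_mono_ae ?_)
    filter_upwards [hX.ae_exists_eq_of_lt hS hA.1 (a := a') ha.1 hax] with ω hω (h : _ = ⊤)
    change hitTime X a' ω < hitTime X y ω
    rw [h]
    exact hitTime_lt_top_iff.2 hω
  have h0 : P x {ω | hitTime X y ω = ⊤} = 0 :=
    (measureReal_eq_zero_iff).1 (le_antisymm hle measureReal_nonneg)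
  filter_upwards [measure_eq_zero_iff_ae_notMem.1 h0] with ω hω
  exact hitTime_lt_top_iff.1 (lt_top_iff_ne_top.2 hω)

/-! ### Large drawdowns -/

/-- Every level is exceeded almost surely. If the left end point belongs to the state space, this
follows from regularity alone; otherwise the diffusion is of the class with `S(l) = -∞`, and every
starting point is interior. -/
theorem ae_exists_lt (hX : IsRegularDiffusion l I X P) (hS : IsScaleFunction l X P S)
    (hclass : IsClassOneA l S ∨ IsClassOneB l X P S) (x : I) (y : ℝ) :
    ∀ᵐ ω ∂(P x), ∃ t, y < (X t ω : ℝ) := by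
  by_cases hmem : ∃ l₀ : I, l = ((l₀ : ℝ) : EReal)
  · obtain ⟨l₀, hl₀⟩ := hmem
    exact hX.ae_exists_lt_of_left_mem hl₀ x y
  have hA : IsClassOneA l S := hclass.resolve_right fun ⟨_, l₀, hl₀, _⟩ => hmem ⟨l₀, hl₀⟩
  have hx : l < ((x : ℝ) : EReal) :=
    (hX.interval.subset_closure x.2).lt_of_ne fun h => hmem ⟨x, h⟩
  have hxz : (x : ℝ) < max (x : ℝ) y + 1 := by linarith [le_max_left (x : ℝ) y]
  filter_upwards [hX.ae_exists_eq_of_gt hS hA hx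
    (y := ⟨_, hX.interval.interior_subset (hX.coe_lt_of_lt hxz)⟩) hxz] with ω ⟨t, ht⟩
  refine ⟨t, ?_⟩
  rw [ht]
  linarith [le_max_right (x : ℝ) y]

/-- Almost surely the path comes above `y` and later below the interior level `c ≤ y`: from any
point above `y` the descent is certain, and a visit above `y` can be observed at a time of a
countable dense set. -/
theorem ae_exists_lt_and_exists_gt (hX : IsRegularDiffusion l I X P)
    (hS : IsScaleFunction l X P S) (hclass : IsClassOneA l S ∨ IsClassOneB l X P S)
    {c y : ℝ} (hc : l < (c : EReal)) (hcy : c ≤ y) (x : I) :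
    ∀ᵐ ω ∂(P x), ∃ s t, s ≤ t ∧ y < (X s ω : ℝ) ∧ (X t ω : ℝ) < c := by
  have htop : Tendsto S atTop atTop := hclass.elim And.left And.left
  obtain ⟨a, hla, hac⟩ := EReal.lt_iff_exists_real_btwn.1 hc
  have hac' : a < c := EReal.coe_lt_coe_iff.1 hac
  have hnull : ∀ w : I, y < (w : ℝ) → P w {ω | (fun s => X s ω) ∈ neverBelow I c} = 0 := by
    intro w hw
    rw [measure_eq_zero_iff_ae_notMem]
    filter_upwards [hX.ae_exists_eq_of_lt hS htop (a := ⟨a, hX.interval.interior_subset hla⟩)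
      (x := w) hla (by change a < (w : ℝ); linarith)] with ω ⟨t, ht⟩ hω
    have := (mem_neverBelow_iff (hX.continuous ω)).1 hω t
    rw [ht] at this
    exact this.not_gt hac'
  -- the Markov property at the countably many times of the dense sequence
  have hall : ∀ᵐ ω ∂(P x), ∀ k, ¬ (y < (X (denseSeq ℝ≥0 k) ω : ℝ) ∧
      (fun s => X (denseSeq ℝ≥0 k + s) ω) ∈ neverBelow I c) := by
    refine ae_all_iff.2 fun k => (measure_eq_zero_iff_ae_notMem (α := Ω)
      (s := {ω | y < (X (denseSeq ℝ≥0 k) ω : ℝ)} ∩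
        {ω | (fun s => X (denseSeq ℝ≥0 k + s) ω) ∈ neverBelow I c})).1 ?_
    have hm := (Filtration.stronglyAdapted_natural
      fun t => (hX.measurable t).stronglyMeasurable) (denseSeq ℝ≥0 k)
    have hAm : MeasurableSet {z : I | y < (z : ℝ)} :=
      measurableSet_lt measurable_const measurable_subtype_coe
    refine (hX.strongMarkov.at_const _ (hm.measurable hAm) (measurableSet_neverBelow c) x).trans ?_
    rw [setLIntegral_congr_fun (hX.measurable _ hAm) (g := fun _ => 0) fun ω hω => hnull _ hω]
    simp
  filter_upwards [hX.ae_exists_lt hS hclass x y, hall] with ω hy h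
  obtain ⟨k, hk⟩ := (exists_denseSeq_mem_iff
    (continuous_subtype_val.comp (hX.continuous ω)) (isOpen_Ioi (a := y))).2 hy
  have hb := fun hmem => h k ⟨hk, hmem⟩
  rw [mem_neverBelow_iff (hX.continuous_shift _ ω)] at hb
  obtain ⟨s, hs⟩ := not_forall.1 hb
  exact ⟨_, _, le_self_add, hk, not_le.1 hs⟩

end IsRegularDiffusion

end Drawdown

theorem proposition3p3 {Ω : Type*} [MeasurableSpace Ω] (l : EReal) (I : Set ℝ)
    (X : ℝ≥0 → Ω → I) (P : Kernel I Ω) (S : ℝ → ℝ)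
    (hX : Drawdown.IsRegularDiffusion l I X P)
    (hS : Drawdown.IsScaleFunction l X P S)
    (hclass : Drawdown.IsClassOneA l S ∨ Drawdown.IsClassOneB l X P S) :
    ∀ x : I, ∀ᵐ ω ∂(P x), ∀ δ : ℝ, 0 < δ →
      Drawdown.drawdownTime X δ ω < ⊤ ∧
        ∃ m : ℝ, Drawdown.maxUpTo X (Drawdown.drawdownTime X δ ω) ω = (m : EReal) := by
  intro x
  obtain ⟨c, hc, -⟩ := EReal.lt_iff_exists_real_btwn.1 hX.interval.lt_top
  filter_upwards [ae_all_iff.2 fun n : ℕ => hX.ae_exists_lt_and_exists_gt hS hclass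
    (y := c + n) hc (by simp) x] with ω hω δ _
  obtain ⟨n, hn⟩ := exists_nat_ge δ
  obtain ⟨s, t, hst, hs, ht⟩ := hω n
  have hfin : Drawdown.drawdownTime X δ ω < ⊤ :=
    Drawdown.drawdownTime_lt_top (hX.continuous ω) hst (by linarith)
  refine ⟨hfin, ?_⟩
  -- up to a finite time the maximum is that of a continuous path over a compact interval
  lift Drawdown.drawdownTime X δ ω to ℝ≥0 using hfin.ne with τ
  exact ⟨_, Drawdown.maxUpTo_coe X τ ω (hX.continuous ω)⟩
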